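/- Let $A$ be a quantum system with Hilbert space $\mathscr H_A=\mathbb C^d$, $d\ge 1$, let $n\ge 0$, and let $A^n$ be the system with Hilbert space $\mathscr H_A^{\otimes n}$. A state on $A^n$ is a positive semidefinite operator of trace one; $L\le K$ means that $K-L$ is positive semidefinite. For $\pi\in S_n$ let $U(\pi)$ be the unitary that permutes the $n$ tensor factors. An operator $L$ on $\mathscr H_A^{\otimes n}$ is permutation invariant if $U(\pi)LU(\pi)^\dagger=L$ for all $\pi\in S_n$, and invariant under product unitaries if $V^{\otimes n}L(V^{\otimes n})^\dagger=L$ for all unitaries $V$ on $\mathscr H_A$. Let $\Lambda_{n,d}$ be the set of Young diagrams with $n$ boxes and at most $d$ rows. For $\lambda\in\Lambda_{n,d}$ let $P^\lambda$ be the orthogonal projector onto the isotypic subspace of type $\lambda$ of the representation $U$ of $S_n$, that is, onto the span of the images of the Young symmetrizers $\big(\sum_{q}\operatorname{sgn}(q)\,U(q)\big)\big(\sum_{p}U(p)\big)$ of all tableaux $T$ of shape $\lambda$ (fillings of the boxes with $1,\dots,n$), where $p$ and $q$ run over the permutations that preserve the rows and the columns of $T$, respectively. Then there exists a state $\omega^n$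 on $A^n$ (a universal state) such that: 1. For all permutation invariant states $\tau$ on $A^n$, $$\tau\le g_{n,d}\,\omega^n,\qquad\text{where}\qquad g_{n,d}=\binom{n+d^2-1}{n}\le (n+1)^{d^2-1}.$$ 2. $\omega^n$ has the eigenvalue decomposition $$\omega^n=\bigoplus_{\lambda\in\Lambda_{n,d}}p_\lambda P^\lambda ,$$ where $|\Lambda_{n,d}|\le (n+1)^{d-1}$, the $P^\lambda$ $(\lambda\in\Lambda_{n,d})$ are nonzero mutually orthogonal projectors with $\sum_{\lambda\in\Lambda_{n,d}}P^\lambda=\mathbf 1$, the $p_\lambda$ are nonnegative real numbers, and $\{p_\lambda\operatorname{tr}P^\lambda\}_{\lambda\in\Lambda_{n,d}}$ is a probability distribution, i.e. $\sum_{\lambda}p_\lambda\operatorname{tr}P^\lambda=1$. In particular, $\omega^n$ is permutation invariant and invariant under product unitaries, and it commutes with all permutation invariant states on $A^n$. -/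

import Mathlib

/-!
A quantum system `A` with `|A| = d` is given by a finite type `A` with `d` elements that labels an
orthonormal basis of its Hilbert space `ℂ^A`. The system `A^n` has Hilbert space `(ℂ^A)^{⊗ n}`, whose
product basis is labelled by `Fin n → A`; operators are complex matrices in this basis.
-/

namespace UniversalState

open scoped Matrix ComplexOrder

/-- Operators on the Hilbert space of `A^n`. -/
abbrev Op (A : Type*) (n : ℕ) : Type _ := Matrix (Fin n → A) (Fin n → A) ℂ

/-- A quantum state: a positive semidefinite operator of trace one. -/
def IsState {I : Type*} [Fintype I] (ρ : Matrix I I ℂ) : Prop :=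
  ρ.PosSemidef ∧ ρ.trace = 1

/-- The operator inequality `L ≤ K`: the difference `K - L` is positive semidefinite. -/
def OpLE {I : Type*} (L K : Matrix I I ℂ) : Prop :=
  (K - L).PosSemidef

section Permutations

variable {A : Type*} [DecidableEq A] {n : ℕ}

/-- The operator `U(π)` that permutes the tensor factors of `A^n`: it maps
`|y₁⟩ ⊗ … ⊗ |yₙ⟩` to the product vector whose `π i`-th factor is `|yᵢ⟩`. -/
def permOp (A : Type*) [DecidableEq A] {n : ℕ} (π : Equiv.Perm (Fin n)) : Op A n :=
  Matrix.of fun x y => if x = y ∘ π.symm then 1 else 0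

theorem permOp_one : permOp A (1 : Equiv.Perm (Fin n)) = 1 := by
  ext x y
  simp [permOp, Matrix.one_apply, Equiv.Perm.one_def]

theorem permOp_mul [Fintype A] (π σ : Equiv.Perm (Fin n)) :
    permOp A (π * σ) = permOp A π * permOp A σ := by
  ext x y
  simp only [permOp, Matrix.mul_apply, Matrix.of_apply, mul_ite, mul_one, mul_zero]
  rw [Finset.sum_eq_single (y ∘ σ.symm)]
  · simp only [Equiv.Perm.mul_def, Function.comp_assoc, if_true]
    congr
  · intro z _ hz
    simp [hz]
  · simp

theorem permOp_conjTranspose (π : Equiv.Perm (Fin n)) :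
    (permOp A π)ᴴ = permOp A π⁻¹ := by
  ext x y
  have h : (y = x ∘ π.symm) ↔ (x = y ∘ π) := by
    constructor
    · rintro rfl
      ext i
      simp
    · rintro rfl
      ext i
      simp
  simp only [permOp, Matrix.conjTranspose_apply, Matrix.of_apply, Equiv.Perm.inv_def,
    Equiv.symm_symm, h]
  split_ifs <;> simp

/-- Permutation invariance: `U(π) L U(π)† = L` for all permutations `π`. -/
def IsPermInvariant [Fintype A] (L : Op A n) : Prop :=
  ∀ π : Equiv.Perm (Fin n), permOp A π * L * (permOp A π)ᴴ = L

/-- The `n`-fold tensor power `V^{⊗ n}` of an operator `V` on `ℂ^A`. -/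
def tensorPow (n : ℕ) (V : Matrix A A ℂ) : Op A n :=
  Matrix.of fun x y => ∏ i, V (x i) (y i)

/-- Invariance under product unitaries: `V^{⊗ n} L (V^{⊗ n})† = L` for all unitaries `V`. -/
def IsProductUnitaryInvariant [Fintype A] (L : Op A n) : Prop :=
  ∀ V ∈ Matrix.unitaryGroup A ℂ, tensorPow n V * L * (tensorPow n V)ᴴ = L

end Permutations

section Young

theorem finite_youngDiagrams (n d : ℕ) :
    {μ : YoungDiagram | μ.card = n ∧ μ.colLen 0 ≤ d}.Finite := by
  have hfin : (((Finset.range n ×ˢ Finset.range n).powerset : Finset (Finset (ℕ × ℕ))) :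
      Set (Finset (ℕ × ℕ))).Finite := Finset.finite_toSet _
  refine Set.Finite.of_injOn (f := YoungDiagram.cells) ?_ ?_ hfin
  · rintro μ ⟨hμ, -⟩
    simp only [Finset.coe_powerset, Set.mem_preimage, Set.mem_powerset_iff, Finset.coe_subset]
    rintro ⟨i, j⟩ hij
    have hij' : (i, j) ∈ μ := hij
    have h1 : i < μ.colLen j := YoungDiagram.mem_iff_lt_colLen.1 hij'
    have h2 : j < μ.rowLen i := YoungDiagram.mem_iff_lt_rowLen.1 hij'
    have h3 : μ.colLen j ≤ μ.card := by
      rw [YoungDiagram.colLen_eq_card]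
      exact Finset.card_le_card (Finset.filter_subset _ _)
    have h4 : μ.rowLen i ≤ μ.card := by
      rw [YoungDiagram.rowLen_eq_card]
      exact Finset.card_le_card (Finset.filter_subset _ _)
    simp only [Finset.mem_product, Finset.mem_range]
    omega
  · intro μ _ ν _ h
    exact YoungDiagram.ext h

/-- The set `Λ_{n,d}` of Young diagrams with `n` boxes and at most `d` rows. -/
noncomputable def youngDiagrams (n d : ℕ) : Finset YoungDiagram :=
  (finite_youngDiagrams n d).toFinset

theorem mem_youngDiagrams {n d : ℕ} {μ : YoungDiagram} :
    μ ∈ youngDiagrams n d ↔ μ.card = n ∧ μ.colLen 0 ≤ d := by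
  simp [youngDiagrams]

variable {n : ℕ} {μ : YoungDiagram}

/-- The permutations that preserve the rows of the tableau `T`. -/
def rowGroup (T : Fin n ≃ μ.cells) : Finset (Equiv.Perm (Fin n)) :=
  {π | ∀ i, (T (π i)).1.1 = (T i).1.1}

/-- The permutations that preserve the columns of the tableau `T`. -/
def colGroup (T : Fin n ≃ μ.cells) : Finset (Equiv.Perm (Fin n)) :=
  {π | ∀ i, (T (π i)).1.2 = (T i).1.2}

/-- The Young symmetrizer of the tableau `T`, acting on `A^n`: symmetrize over the rows of `T`, then
antisymmetrize over its columns. -/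
noncomputable def youngSymmetrizer (A : Type*) [Fintype A] [DecidableEq A]
    (T : Fin n ≃ μ.cells) : Op A n :=
  (∑ q ∈ colGroup T, ((Equiv.Perm.sign q : ℤ) : ℂ) • permOp A q) * ∑ p ∈ rowGroup T, permOp A p

/-- The subspace of `(ℂ^A)^{⊗ n}` on which the symmetric group acts by copies of the irreducible
representation labelled by `μ`: the span of the images of the Young symmetrizers of all tableaux
of shape `μ`. -/
noncomputable def isotypic (A : Type*) [Fintype A] [DecidableEq A] (n : ℕ) (μ : YoungDiagram) :
    Submodule ℂ (EuclideanSpace ℂ (Fin n → A)) :=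
  ⨆ T : Fin n ≃ μ.cells, LinearMap.range (Matrix.toEuclideanLin (youngSymmetrizer A T))

/-- The orthogonal projector `P^μ` onto the isotypic subspace of type `μ`. -/
noncomputable def isotypicProj (A : Type*) [Fintype A] [DecidableEq A] (n : ℕ)
    (μ : YoungDiagram) : Op A n :=
  Matrix.toEuclideanLin.symm ((isotypic A n μ).starProjection : _ →ₗ[ℂ] _)

end Young

end UniversalState

/-!
The operator `ω` is `1 / (g n!) ∑ tr U(π) U(π)`, which is the marginal on `A^n` of the normalized
projector onto the symmetric subspace of `(ℂ^A ⊗ ℂ^A)^{⊗ n}`.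

*Normalization.* Since `(tr U(π))²` is the number of fixed points of `π` on `(A × A)ⁿ`, Burnside's
lemma identifies `tr ω` with the number of multisets of size `n` in `A × A`, divided by `g`
(`sum_trace_permOp_sq`).

*Domination.* A permutation invariant state `τ` has a permutation invariant square root `S`, a unit
vector for the Hilbert–Schmidt inner product. Hence `(S v)_w = tr (S |v⟩⟨w|)` does not change when
`|v⟩⟨w|` is twirled over the permutations, and by Bessel's inequality `⟨v, τ v⟩ = ∑ |(S v)_w|²` is
at most the sum of the squared Hilbert–Schmidt lengths of the twirled operators. That sum is
`g ⟨v, ω v⟩` (`dotProduct_rep_traceElt_mulVec`, `opLE_rep_traceElt`).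

*Spectral decomposition.* The coefficients `tr U(π)` form a class function, so `ω` represents a
central element of the group algebra of `Sₙ`. Write `b a` for the Young symmetrizer of a tableau
(row sum `a`, column sum `b`). For each diagram `μ` with `n` boxes, the sum `z_μ` of `b a a b` over
all tableaux of shape `μ` is central (`shapeElt`). Comparing shapes in the dominance order shows
that the symmetrizers of different shapes are orthogonal, so `z_μ z_ν = 0` for `μ ≠ ν`
(`exists_common_row_col`, `shapeElt_mul_of_ne`). As `z_μ` acts on `(ℂⁿ)^{⊗ n}` by a nonzero
Hermitian operator, `z_μ² ≠ 0`; hence the `z_μ` are linearly independent. The dimension of the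
center is the number of conjugacy classes of `Sₙ`, which is at most the number of diagrams, so the
`z_μ` are a basis of the center (`exists_eq_sum_shapeElt`). The components of the unit in this
basis are therefore Hermitian idempotents that span the center and sum to the unit. Their images on
`(ℂ^A)^{⊗ n}` are the projectors onto the isotypic subspaces (`isotypicProj_eq_rep`), and so every
central element, in particular `ω`, is a combination of these projectors. A diagram contributes
exactly when it has at most `|A|` rows (`youngSymmetrizer_eq_zero`, `youngSymmetrizer_ne_zero`).
-/

namespace UniversalState

open scoped Matrix ComplexOrder

/-! ### Combinatorics of Young diagrams and tableaux -/

theorem mem_rowGroup {n : ℕ} {μ : YoungDiagram} {T : Fin n ≃ μ.cells} {π : Equiv.Perm (Fin n)} :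
    π ∈ rowGroup T ↔ ∀ i, (T (π i)).1.1 = (T i).1.1 := by
  simp [rowGroup]

theorem mem_colGroup {n : ℕ} {μ : YoungDiagram} {T : Fin n ≃ μ.cells} {π : Equiv.Perm (Fin n)} :
    π ∈ colGroup T ↔ ∀ i, (T (π i)).1.2 = (T i).1.2 := by
  simp [colGroup]

theorem swap_mem_rowGroup {n : ℕ} {μ : YoungDiagram} {T : Fin n ≃ μ.cells} {i j : Fin n}
    (h : (T i).1.1 = (T j).1.1) : Equiv.swap i j ∈ rowGroup T := by
  rw [mem_rowGroup]
  intro k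
  rw [Equiv.swap_apply_def]
  split_ifs <;> simp_all

theorem swap_mem_colGroup {n : ℕ} {μ : YoungDiagram} {T : Fin n ≃ μ.cells} {i j : Fin n}
    (h : (T i).1.2 = (T j).1.2) : Equiv.swap i j ∈ colGroup T := by
  rw [mem_colGroup]
  intro k
  rw [Equiv.swap_apply_def]
  split_ifs <;> simp_all

theorem colLen_zero_le_card (μ : YoungDiagram) : μ.colLen 0 ≤ μ.card := by
  rw [YoungDiagram.colLen_eq_card]
  exact Finset.card_le_card (Finset.filter_subset _ _)

theorem fst_lt_colLen_zero {μ : YoungDiagram} (c : μ.cells) : c.1.1 < μ.colLen 0 := by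
  have h : (c.1.1, c.1.2) ∈ μ := c.2
  exact lt_of_lt_of_le (YoungDiagram.mem_iff_lt_colLen.1 h) (μ.colLen_anti _ _ (Nat.zero_le _))

theorem ext_of_rowLen_eq {μ ν : YoungDiagram} (h : ∀ k, μ.rowLen k = ν.rowLen k) : μ = ν := by
  apply YoungDiagram.ext
  ext ⟨i, j⟩
  have h1 : (i, j) ∈ μ ↔ (i, j) ∈ ν := by
    rw [YoungDiagram.mem_iff_lt_rowLen, YoungDiagram.mem_iff_lt_rowLen, h]
  exact h1

theorem card_rows_lt_succ (μ : YoungDiagram) (k : ℕ) :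
    (μ.cells.filter (·.1 < k + 1)).card = (μ.cells.filter (·.1 < k)).card + μ.rowLen k := by
  rw [YoungDiagram.rowLen_eq_card, YoungDiagram.row, ← Finset.card_union_of_disjoint]
  · congr 1
    ext c
    simp only [Finset.mem_filter, Finset.mem_union]
    constructor
    · rintro ⟨h1, h2⟩
      rcases Nat.lt_succ_iff_lt_or_eq.1 h2 with h | h
      · exact Or.inl ⟨h1, h⟩
      · exact Or.inr ⟨h1, h⟩
    · rintro (⟨h1, h2⟩ | ⟨h1, h2⟩)
      · exact ⟨h1, by omega⟩
      · exact ⟨h1, by omega⟩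
  · rw [Finset.disjoint_filter]
    intro c _ h1 h2
    omega

theorem card_rows_lt_eq_sum (μ : YoungDiagram) (k : ℕ) :
    (μ.cells.filter (·.1 < k)).card = ∑ i ∈ Finset.range k, μ.rowLen i := by
  induction k with
  | zero => simp
  | succ k ih => rw [card_rows_lt_succ, ih, Finset.sum_range_succ]

theorem card_eq_sum_rowLen {μ : YoungDiagram} {d : ℕ} (h : μ.colLen 0 ≤ d) :
    μ.card = ∑ i ∈ Finset.range d, μ.rowLen i := by
  rw [← card_rows_lt_eq_sum, YoungDiagram.card, Finset.filter_true_of_mem]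
  intro c hc
  exact lt_of_lt_of_le (fst_lt_colLen_zero ⟨c, hc⟩) h

/-- If no two entries share a row of `T` and a column of `S`, then the shape of `S` dominates the
shape of `T`: each column of `S` contains at most `k` entries from the first `k` rows of `T`. -/
theorem card_rows_lt_le {n : ℕ} {μ ν : YoungDiagram} (T : Fin n ≃ μ.cells) (S : Fin n ≃ ν.cells)
    (h : ∀ i j, (T i).1.1 = (T j).1.1 → (S i).1.2 = (S j).1.2 → i = j) (k : ℕ) :
    (μ.cells.filter (·.1 < k)).card ≤ (ν.cells.filter (·.1 < k)).card := by
  have h1 : (μ.cells.filter (·.1 < k)).card =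
      (Finset.univ.filter fun i : Fin n => (T i).1.1 < k).card := by
    symm
    refine Finset.card_bij (fun i _ => (T i).1) ?_ ?_ ?_
    · intro i hi
      simpa using hi
    · intro i _ j _ hij
      exact T.injective (Subtype.ext hij)
    · intro c hc
      rw [Finset.mem_filter] at hc
      exact ⟨T.symm ⟨c, hc.1⟩, by simpa using hc.2, by simp⟩
  rw [h1, Finset.card_eq_sum_card_fiberwise (f := fun i => (S i).1.2) (t := ν.cells.image Prod.snd)
    (by intro i _; simpa using ⟨_, (S i).2⟩),
    Finset.card_eq_sum_card_fiberwise (s := ν.cells.filter (·.1 < k))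
      (f := Prod.snd) (t := ν.cells.image Prod.snd)
      (by intro c hc; exact Finset.mem_image_of_mem _ (Finset.mem_filter.1 hc).1)]
  refine Finset.sum_le_sum fun j _ => ?_
  -- column `j` of the target has `min k (ν.colLen j)` cells in its first `k` rows
  have h2 : min k (ν.colLen j) ≤
      ((ν.cells.filter (·.1 < k)).filter fun c => c.2 = j).card := by
    rw [← Finset.card_range (min k (ν.colLen j))]
    refine Finset.card_le_card_of_injOn (fun i => (i, j)) ?_ ?_
    · intro i hi
      have hi' : i < k ∧ i < ν.colLen j := by simpa using hi
      have hm : (i, j) ∈ ν := YoungDiagram.mem_iff_lt_colLen.2 hi'.2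
      simpa using ⟨hm, hi'.1⟩
    · intro a _ b _ hab
      exact (Prod.ext_iff.1 hab).1
  refine le_trans (le_min ?_ ?_) h2
  · rw [← Finset.card_range k]
    refine Finset.card_le_card_of_injOn (fun i => (T i).1.1) ?_ ?_
    · intro i hi
      simp only [Finset.coe_filter, Set.mem_ofPred_eq, Finset.mem_filter, Finset.mem_univ,
        true_and] at hi
      simpa using hi.1
    · intro a ha b hb hab
      simp only [Finset.coe_filter, Set.mem_ofPred_eq, Finset.mem_filter, Finset.mem_univ,
        true_and] at ha hb
      exact h a b hab (ha.2.trans hb.2.symm)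
  · rw [YoungDiagram.colLen_eq_card]
    refine Finset.card_le_card_of_injOn (fun i => (S i).1) ?_ ?_
    · intro i hi
      simp only [Finset.coe_filter, Set.mem_ofPred_eq, Finset.mem_filter, Finset.mem_univ,
        true_and] at hi
      exact YoungDiagram.mem_col_iff.2 ⟨(S i).2, hi.2⟩
    · intro a _ b _ hab
      exact S.injective (Subtype.ext hab)

/-- For different shapes, in at least one of the two orders every pair of tableaux has two entries
in a common row of the first and a common column of the second. -/
theorem exists_common_row_col {n : ℕ} {μ ν : YoungDiagram} (hne : μ ≠ ν) :
    (∀ (T : Fin n ≃ μ.cells) (S : Fin n ≃ ν.cells),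
      ∃ i j, i ≠ j ∧ (T i).1.1 = (T j).1.1 ∧ (S i).1.2 = (S j).1.2) ∨
    (∀ (T : Fin n ≃ μ.cells) (S : Fin n ≃ ν.cells),
      ∃ i j, i ≠ j ∧ (S i).1.1 = (S j).1.1 ∧ (T i).1.2 = (T j).1.2) := by
  by_contra hcon
  push Not at hcon
  obtain ⟨⟨T, S, h⟩, T', S', h'⟩ := hcon
  have h1 := card_rows_lt_le T S fun i j hr hc => by
    by_contra hij
    exact h i j hij hr hc
  have h2 := card_rows_lt_le S' T' fun i j hr hc => by
    by_contra hij
    exact h' i j hij hr hc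
  apply hne
  apply ext_of_rowLen_eq
  intro k
  have e0 := le_antisymm (h1 k) (h2 k)
  have e1 := le_antisymm (h1 (k + 1)) (h2 (k + 1))
  rw [card_rows_lt_succ, card_rows_lt_succ, e0] at e1
  exact Nat.add_left_cancel e1

/-- A diagram with `n` boxes and at most `d` rows is determined by its rows other than the
first, because the first row is what is left of the `n` boxes. -/
theorem card_youngDiagrams_le {d : ℕ} (hd : 1 ≤ d) (n : ℕ) :
    (youngDiagrams n d).card ≤ (n + 1) ^ (d - 1) := by
  obtain ⟨d, rfl⟩ : ∃ e, d = e + 1 := ⟨d - 1, by omega⟩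
  have hc : (n + 1) ^ (d + 1 - 1) = (Finset.univ : Finset (Fin d → Fin (n + 1))).card := by
    simp
  rw [hc]
  refine Finset.card_le_card_of_injOn
    (fun μ i => Fin.ofNat (n + 1) (μ.rowLen (i + 1)))
    (fun _ _ => Finset.mem_coe.2 (Finset.mem_univ _)) ?_
  have hle : ∀ μ ∈ youngDiagrams n (d + 1), ∀ k, μ.rowLen k ≤ n := by
    intro μ hμ k
    rw [← (mem_youngDiagrams.1 hμ).1, YoungDiagram.rowLen_eq_card]
    exact Finset.card_le_card (Finset.filter_subset _ _)
  intro μ hμ ν hν h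
  have hrow : ∀ k < d, μ.rowLen (k + 1) = ν.rowLen (k + 1) := by
    intro k hk
    have := congrArg Fin.val (congrFun h ⟨k, hk⟩)
    simp only [Fin.ofNat] at this
    rwa [Nat.mod_eq_of_lt (Nat.lt_succ_of_le (hle μ hμ _)),
      Nat.mod_eq_of_lt (Nat.lt_succ_of_le (hle ν hν _))] at this
  obtain ⟨hμn, hμd⟩ := mem_youngDiagrams.1 hμ
  obtain ⟨hνn, hνd⟩ := mem_youngDiagrams.1 hν
  have hzero : ∀ κ : YoungDiagram, κ.colLen 0 ≤ d + 1 → ∀ k, d < k → κ.rowLen k = 0 := by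
    intro κ hκ k hk
    by_contra hne
    have hm := YoungDiagram.mem_iff_lt_colLen.1
      (YoungDiagram.mem_iff_lt_rowLen.2 (Nat.pos_of_ne_zero hne))
    omega
  have h0 : μ.rowLen 0 = ν.rowLen 0 := by
    have e := (card_eq_sum_rowLen hμd).symm.trans
      (hμn.trans (hνn.symm.trans (card_eq_sum_rowLen hνd)))
    rw [Finset.sum_range_succ', Finset.sum_range_succ',
      Finset.sum_congr rfl fun k hk => hrow k (Finset.mem_range.1 hk)] at e
    exact Nat.add_left_cancel e
  apply ext_of_rowLen_eq
  intro k
  rcases k with _ | k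
  · exact h0
  · by_cases hk : k < d
    · exact hrow k hk
    · rw [hzero μ hμd _ (by omega), hzero ν hνd _ (by omega)]

theorem choose_add_le_pow (n k : ℕ) : (n + k).choose n ≤ (n + 1) ^ k := by
  induction k with
  | zero => simp
  | succ k ih =>
    have h := Nat.add_one_mul_choose_eq (n + k) k
    rw [Nat.choose_symm_add] at ih
    rw [Nat.choose_symm_add]
    have h2 : (n + (k + 1)).choose (k + 1) * (k + 1) ≤ (n + 1) ^ (k + 1) * (k + 1) := by
      rw [← add_assoc, ← h, pow_succ]
      calc (n + k + 1) * (n + k).choose k ≤ ((n + 1) * (k + 1)) * (n + 1) ^ k :=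
            Nat.mul_le_mul (by nlinarith) ih
        _ = _ := by ring
    exact Nat.le_of_mul_le_mul_right h2 (Nat.succ_pos k)

/-- There are at most as many conjugacy classes of `Sₙ` as Young diagrams with `n` boxes: the cycle
type, sorted, gives the row lengths of a diagram. -/
theorem card_conjClasses_le (n : ℕ) :
    Nat.card (ConjClasses (Equiv.Perm (Fin n))) ≤ (youngDiagrams n n).card := by
  classical
  have hsorted : ∀ p : (Fintype.card (Fin n)).Partition, (p.parts.sort (· ≥ ·)).SortedGE := fun p =>
    (Multiset.pairwise_sort p.parts (· ≥ ·)).sortedGE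
  let f : (Fintype.card (Fin n)).Partition → YoungDiagram := fun p =>
    YoungDiagram.ofRowLens (p.parts.sort (· ≥ ·)) (hsorted p)
  have hpos : ∀ p : (Fintype.card (Fin n)).Partition, ∀ x ∈ p.parts.sort (· ≥ ·), 0 < x :=
    fun p x hx => p.parts_pos (by simpa using hx)
  have hrl : ∀ p, (f p).rowLens = p.parts.sort (· ≥ ·) := fun p =>
    YoungDiagram.rowLens_ofRowLens_eq_self (hpos p)
  have hf : ∀ p, f p ∈ youngDiagrams n n := by
    intro p
    have hcard : (f p).card = n := by
      have h1 : (f p).rowLens.sum = n := by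
        rw [hrl, ← Multiset.sum_coe, Multiset.sort_eq, p.parts_sum, Fintype.card_fin]
      rw [card_eq_sum_rowLen le_rfl, ← h1, YoungDiagram.rowLens]
      rfl
    exact mem_youngDiagrams.2 ⟨hcard, (colLen_zero_le_card _).trans hcard.le⟩
  have hfi : Function.Injective f := by
    intro p q h
    have h1 := congrArg YoungDiagram.rowLens h
    rw [hrl, hrl] at h1
    have h2 := congrArg (fun l : List ℕ => (l : Multiset ℕ)) h1
    simp only [Multiset.sort_eq] at h2
    exact Nat.Partition.ext h2
  let g : ConjClasses (Equiv.Perm (Fin n)) → youngDiagrams n n := fun c =>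
    ⟨f (Quotient.out c).partition, hf _⟩
  have hg : Function.Injective g := by
    intro c c' h
    have h1 := hfi (Subtype.ext_iff.1 h)
    have h2 := Equiv.Perm.partition_eq_of_isConj.2 h1
    rw [← Quotient.out_eq c, ← Quotient.out_eq c']
    exact Quotient.sound h2
  have := Nat.card_le_card_of_injective g hg
  simpa using this

/-! ### Row and column sums in the group algebra -/

/-- The complex group algebra of the symmetric group `Sₙ`. -/
abbrev GroupAlg (n : ℕ) : Type := MonoidAlgebra ℂ (Equiv.Perm (Fin n))

/-- The basis element of the group algebra given by a permutation. -/
noncomputable abbrev permElt {n : ℕ} (g : Equiv.Perm (Fin n)) : GroupAlg n :=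
  MonoidAlgebra.of ℂ (Equiv.Perm (Fin n)) g

section Sums

variable {n : ℕ} {μ ν : YoungDiagram}

/-- The row symmetrizer of a tableau. -/
noncomputable def rowSum (T : Fin n ≃ μ.cells) : GroupAlg n :=
  ∑ p ∈ rowGroup T, permElt p

/-- The column antisymmetrizer of a tableau. -/
noncomputable def colSum (T : Fin n ≃ μ.cells) : GroupAlg n :=
  ∑ q ∈ colGroup T, ((Equiv.Perm.sign q : ℤ) : ℂ) • permElt q

/-- The action of permutations on tableaux by relabelling the entries. -/
def relabel (g : Equiv.Perm (Fin n)) (T : Fin n ≃ μ.cells) : Fin n ≃ μ.cells :=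
  g.symm.trans T

theorem relabel_apply (g : Equiv.Perm (Fin n)) (T : Fin n ≃ μ.cells) (i : Fin n) :
    relabel g T i = T (g.symm i) := rfl

theorem conj_mem_rowGroup_relabel (g π : Equiv.Perm (Fin n)) (T : Fin n ≃ μ.cells) :
    π ∈ rowGroup T ↔ MulAut.conj g π ∈ rowGroup (relabel g T) := by
  simp only [mem_rowGroup, relabel_apply, MulAut.conj_apply, Equiv.Perm.mul_apply,
    Equiv.Perm.inv_def, Equiv.symm_apply_apply]
  exact ⟨fun h i => h _, fun h i => by simpa using h (g i)⟩

theorem conj_mem_colGroup_relabel (g π : Equiv.Perm (Fin n)) (T : Fin n ≃ μ.cells) :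
    π ∈ colGroup T ↔ MulAut.conj g π ∈ colGroup (relabel g T) := by
  simp only [mem_colGroup, relabel_apply, MulAut.conj_apply, Equiv.Perm.mul_apply,
    Equiv.Perm.inv_def, Equiv.symm_apply_apply]
  exact ⟨fun h i => h _, fun h i => by simpa using h (g i)⟩

theorem permElt_mul_rowSum (g : Equiv.Perm (Fin n)) (T : Fin n ≃ μ.cells) :
    permElt g * rowSum T = rowSum (relabel g T) * permElt g := by
  rw [rowSum, rowSum, Finset.mul_sum, Finset.sum_mul]
  refine Finset.sum_equiv (MulAut.conj g).toEquiv (conj_mem_rowGroup_relabel g · T) fun p _ => ?_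
  simp only [permElt, ← map_mul]
  simp

theorem permElt_mul_colSum (g : Equiv.Perm (Fin n)) (T : Fin n ≃ μ.cells) :
    permElt g * colSum T = colSum (relabel g T) * permElt g := by
  rw [colSum, colSum, Finset.mul_sum, Finset.sum_mul]
  refine Finset.sum_equiv (MulAut.conj g).toEquiv (conj_mem_colGroup_relabel g · T) fun p _ => ?_
  have hs : Equiv.Perm.sign ((MulAut.conj g).toEquiv p) = Equiv.Perm.sign p := by
    simp [mul_right_comm (Equiv.Perm.sign g)]
  rw [hs, mul_smul_comm, smul_mul_assoc]
  simp only [permElt, ← map_mul]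
  simp

theorem rowSum_mul_permElt {p : Equiv.Perm (Fin n)} {T : Fin n ≃ μ.cells} (hp : p ∈ rowGroup T) :
    rowSum T * permElt p = rowSum T := by
  rw [rowSum, Finset.sum_mul]
  refine Finset.sum_equiv (Equiv.mulRight p) (fun r => ?_) fun r _ => ?_
  · rw [mem_rowGroup] at hp
    simp only [mem_rowGroup, Equiv.coe_mulRight, Equiv.Perm.mul_apply]
    exact ⟨fun h i => (h _).trans (hp i), fun h i => by
      have h1 := h (p.symm i)
      have h2 := hp (p.symm i)
      simp only [Equiv.apply_symm_apply] at h1 h2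
      exact h1.trans h2.symm⟩
  · simp only [permElt, ← map_mul]
    rfl

theorem permElt_mul_rowSum_of_mem {p : Equiv.Perm (Fin n)} {T : Fin n ≃ μ.cells}
    (hp : p ∈ rowGroup T) : permElt p * rowSum T = rowSum T := by
  rw [rowSum, Finset.mul_sum]
  refine Finset.sum_equiv (Equiv.mulLeft p) (fun r => ?_) fun r _ => ?_
  · rw [mem_rowGroup] at hp
    simp only [mem_rowGroup, Equiv.coe_mulLeft, Equiv.Perm.mul_apply, hp]
  · simp only [permElt, ← map_mul]
    rfl

theorem permElt_mul_colSum_of_mem {q : Equiv.Perm (Fin n)} {T : Fin n ≃ μ.cells}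
    (hq : q ∈ colGroup T) :
    permElt q * colSum T = ((Equiv.Perm.sign q : ℤ) : ℂ) • colSum T := by
  rw [colSum, Finset.mul_sum, Finset.smul_sum]
  refine Finset.sum_equiv (Equiv.mulLeft q) (fun r => ?_) fun r _ => ?_
  · rw [mem_colGroup] at hq
    simp only [mem_colGroup, Equiv.coe_mulLeft, Equiv.Perm.mul_apply, hq]
  · rw [mul_smul_comm, smul_smul, Equiv.coe_mulLeft, ← Int.cast_mul, ← Units.val_mul,
      Equiv.Perm.sign_mul, ← mul_assoc, Int.units_mul_self, one_mul]
    simp only [permElt, ← map_mul]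

theorem colSum_mul_permElt {q : Equiv.Perm (Fin n)} {T : Fin n ≃ μ.cells} (hq : q ∈ colGroup T) :
    colSum T * permElt q = ((Equiv.Perm.sign q : ℤ) : ℂ) • colSum T := by
  rw [colSum, Finset.sum_mul, Finset.smul_sum]
  refine Finset.sum_equiv (Equiv.mulRight q) (fun r => ?_) fun r _ => ?_
  · rw [mem_colGroup] at hq
    simp only [mem_colGroup, Equiv.coe_mulRight, Equiv.Perm.mul_apply]
    exact ⟨fun h i => (h _).trans (hq i), fun h i => by
      have h1 := h (q.symm i)
      have h2 := hq (q.symm i)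
      simp only [Equiv.apply_symm_apply] at h1 h2
      exact h1.trans h2.symm⟩
  · rw [smul_mul_assoc, smul_smul, Equiv.coe_mulRight, ← Int.cast_mul, ← Units.val_mul,
      Equiv.Perm.sign_mul, mul_left_comm, Int.units_mul_self, mul_one]
    simp only [permElt, ← map_mul]

variable {T : Fin n ≃ μ.cells} {S : Fin n ≃ ν.cells} {i j : Fin n}

theorem eq_zero_of_eq_neg_self {x : GroupAlg n} (h : x = -x) : x = 0 := by
  have h2 : (2 : ℂ) • x = 0 := by
    rw [two_smul]
    nth_rewrite 2 [h]
    exact add_neg_cancel x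
  exact (smul_eq_zero.1 h2).resolve_left two_ne_zero

/-- The transposition of two entries in a common row of `T` and a common column of `S` is absorbed
by the row sum and changes the sign of the column sum. -/
theorem rowSum_mul_colSum_eq_zero (hij : i ≠ j) (hr : (T i).1.1 = (T j).1.1)
    (hc : (S i).1.2 = (S j).1.2) : rowSum T * colSum S = 0 := by
  apply eq_zero_of_eq_neg_self
  nth_rewrite 1 [← rowSum_mul_permElt (swap_mem_rowGroup hr)]
  rw [mul_assoc, permElt_mul_colSum_of_mem (swap_mem_colGroup hc), Equiv.Perm.sign_swap hij]
  simp

theorem colSum_mul_rowSum_eq_zero (hij : i ≠ j) (hr : (T i).1.1 = (T j).1.1)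
    (hc : (S i).1.2 = (S j).1.2) : colSum S * rowSum T = 0 := by
  apply eq_zero_of_eq_neg_self
  nth_rewrite 1 [← permElt_mul_rowSum_of_mem (swap_mem_rowGroup hr)]
  rw [← mul_assoc, colSum_mul_permElt (swap_mem_colGroup hc), Equiv.Perm.sign_swap hij]
  simp

theorem rowSum_mul_mul_colSum_eq_zero
    (h : ∀ (T : Fin n ≃ μ.cells) (S : Fin n ≃ ν.cells),
      ∃ i j, i ≠ j ∧ (T i).1.1 = (T j).1.1 ∧ (S i).1.2 = (S j).1.2)
    (T : Fin n ≃ μ.cells) (S : Fin n ≃ ν.cells) (x : GroupAlg n) :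
    rowSum T * x * colSum S = 0 := by
  induction x using MonoidAlgebra.induction_on with
  | of g =>
    rw [mul_assoc, permElt_mul_colSum, ← mul_assoc]
    obtain ⟨i, j, hij, hr, hc⟩ := h T (relabel g S)
    rw [rowSum_mul_colSum_eq_zero hij hr hc, zero_mul]
  | add x y hx hy => rw [mul_add, add_mul, hx, hy, add_zero]
  | smul c x hx => rw [mul_smul_comm, smul_mul_assoc, hx, smul_zero]

theorem colSum_mul_mul_rowSum_eq_zero
    (h : ∀ (T : Fin n ≃ μ.cells) (S : Fin n ≃ ν.cells),
      ∃ i j, i ≠ j ∧ (T i).1.1 = (T j).1.1 ∧ (S i).1.2 = (S j).1.2)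
    (T : Fin n ≃ μ.cells) (S : Fin n ≃ ν.cells) (x : GroupAlg n) :
    colSum S * x * rowSum T = 0 := by
  induction x using MonoidAlgebra.induction_on with
  | of g =>
    rw [mul_assoc, permElt_mul_rowSum, ← mul_assoc]
    obtain ⟨i, j, hij, hr, hc⟩ := h (relabel g T) S
    rw [colSum_mul_rowSum_eq_zero hij hr hc, zero_mul]
  | add x y hx hy => rw [mul_add, add_mul, hx, hy, add_zero]
  | smul c x hx => rw [mul_smul_comm, smul_mul_assoc, hx, smul_zero]

/-- For different shapes, either row sums against column sums vanish or column sums against row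
sums vanish; this product contains both patterns. -/
theorem rowSum_colSum_mul_colSum_rowSum_eq_zero (hne : μ ≠ ν) (T : Fin n ≃ μ.cells)
    (S : Fin n ≃ ν.cells) : rowSum T * colSum T * (colSum S * rowSum S) = 0 := by
  rcases exists_common_row_col (n := n) hne with h | h
  · rw [← mul_assoc, rowSum_mul_mul_colSum_eq_zero h, zero_mul]
  · rw [mul_assoc, ← mul_assoc (colSum T),
      colSum_mul_mul_rowSum_eq_zero (fun T S => h S T), mul_zero]

end Sums

/-! ### Central elements attached to Young diagrams -/

section Central

variable {n : ℕ} {μ ν : YoungDiagram}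

/-- The sum over all tableaux of shape `μ` of the Young symmetrizer times its adjoint. It is
central, and it is a positive multiple of the central idempotent of type `μ`. -/
noncomputable def shapeElt (n : ℕ) (μ : YoungDiagram) : GroupAlg n :=
  open scoped Classical in
  ∑ T : Fin n ≃ μ.cells, colSum T * rowSum T * (rowSum T * colSum T)

theorem shapeElt_mul_of_ne (hne : μ ≠ ν) : shapeElt n μ * shapeElt n ν = 0 := by
  classical
  rw [shapeElt, shapeElt, Finset.sum_mul_sum]
  refine Finset.sum_eq_zero fun T _ => Finset.sum_eq_zero fun S _ => ?_
  rw [← mul_assoc, mul_assoc (colSum T * rowSum T), rowSum_colSum_mul_colSum_rowSum_eq_zero hne,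
    mul_zero, zero_mul]

theorem shapeElt_mul_symmetrizer_of_ne (hne : μ ≠ ν) (S : Fin n ≃ ν.cells) :
    shapeElt n μ * (colSum S * rowSum S) = 0 := by
  classical
  rw [shapeElt, Finset.sum_mul]
  refine Finset.sum_eq_zero fun T _ => ?_
  rw [mul_assoc, rowSum_colSum_mul_colSum_rowSum_eq_zero hne, mul_zero]

theorem permElt_mul_shapeElt (g : Equiv.Perm (Fin n)) :
    permElt g * shapeElt n μ = shapeElt n μ * permElt g := by
  classical
  rw [shapeElt, Finset.mul_sum, Finset.sum_mul]
  refine Finset.sum_equiv (Equiv.equivCongr g (Equiv.refl _)) (by simp) fun T _ => ?_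
  have h : Equiv.equivCongr g (Equiv.refl _) T = relabel g T := rfl
  rw [h]
  simp only [← mul_assoc]
  rw [permElt_mul_colSum, mul_assoc (colSum _), permElt_mul_rowSum, ← mul_assoc,
    mul_assoc _ (permElt g) (rowSum T), permElt_mul_rowSum, ← mul_assoc,
    mul_assoc _ (permElt g) (colSum T), permElt_mul_colSum, ← mul_assoc]

theorem mem_center_of_commute_permElt {x : GroupAlg n}
    (h : ∀ g, permElt g * x = x * permElt g) : x ∈ Subalgebra.center ℂ (GroupAlg n) := by
  rw [Subalgebra.mem_center_iff]
  intro y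
  induction y using MonoidAlgebra.induction_on with
  | of g => exact h g
  | add y z hy hz => rw [mul_add, add_mul, hy, hz]
  | smul c y hy => rw [mul_smul_comm, smul_mul_assoc, hy]

theorem shapeElt_mem_center : shapeElt n μ ∈ Subalgebra.center ℂ (GroupAlg n) :=
  mem_center_of_commute_permElt permElt_mul_shapeElt

theorem coeff_eq_of_mem_center {x : GroupAlg n} (hx : x ∈ Subalgebra.center ℂ (GroupAlg n))
    {g h : Equiv.Perm (Fin n)} (hgh : IsConj g h) : x.coeff g = x.coeff h := by
  obtain ⟨c, rfl⟩ := isConj_iff.1 hgh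
  have h1 := (Subalgebra.mem_center_iff.1 hx) (permElt c)
  have h2 := congrArg (fun y : GroupAlg n => y.coeff (c * g)) h1
  simpa [permElt] using h2

/-- Central elements are constant on conjugacy classes. -/
theorem finrank_center_le (n : ℕ) :
    Module.finrank ℂ (Subalgebra.center ℂ (GroupAlg n)) ≤ (youngDiagrams n n).card := by
  classical
  let f : Subalgebra.center ℂ (GroupAlg n) →ₗ[ℂ] (ConjClasses (Equiv.Perm (Fin n)) → ℂ) :=
    { toFun := fun x c => x.1.coeff (Quotient.out c)
      map_add' := fun x y => by ext c; simp
      map_smul' := fun c x => by ext; simp }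
  have hf : Function.Injective f := by
    intro x y h
    apply Subtype.ext
    ext g
    have h1 : IsConj g (Quotient.out (ConjClasses.mk g)) :=
      (Quotient.mk_out (s := IsConj.setoid _) g).symm
    rw [coeff_eq_of_mem_center x.2 h1, coeff_eq_of_mem_center y.2 h1]
    exact congrFun h _
  have h1 := LinearMap.finrank_le_finrank_of_injective hf
  rw [Module.finrank_fintype_fun_eq_card, ← Nat.card_eq_fintype_card] at h1
  exact h1.trans (card_conjClasses_le n)

end Central

/-! ### The representation on the tensor power -/

section Representation

variable (A : Type*) [Fintype A] [DecidableEq A] {n : ℕ} {μ ν : YoungDiagram}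

/-- The representation `U` of the symmetric group on `(ℂ^A)^{⊗ n}`, extended to the group
algebra. -/
noncomputable def rep (n : ℕ) : GroupAlg n →ₐ[ℂ] Op A n :=
  MonoidAlgebra.lift ℂ (Op A n) (Equiv.Perm (Fin n))
    { toFun := permOp A
      map_one' := permOp_one
      map_mul' := permOp_mul }

theorem rep_permElt (g : Equiv.Perm (Fin n)) : rep A n (permElt g) = permOp A g :=
  MonoidAlgebra.lift_of _ _

theorem rep_symmetrizer (T : Fin n ≃ μ.cells) :
    rep A n (colSum T * rowSum T) = youngSymmetrizer A T := by
  simp only [colSum, rowSum, youngSymmetrizer, map_mul, map_sum, map_smul, rep_permElt]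

theorem inv_mem_rowGroup {T : Fin n ≃ μ.cells} {p : Equiv.Perm (Fin n)} :
    p⁻¹ ∈ rowGroup T ↔ p ∈ rowGroup T := by
  simp only [mem_rowGroup, Equiv.Perm.inv_def]
  exact ⟨fun h i => by simpa using (h (p i)).symm, fun h i => by simpa using (h (p.symm i)).symm⟩

theorem inv_mem_colGroup {T : Fin n ≃ μ.cells} {p : Equiv.Perm (Fin n)} :
    p⁻¹ ∈ colGroup T ↔ p ∈ colGroup T := by
  simp only [mem_colGroup, Equiv.Perm.inv_def]
  exact ⟨fun h i => by simpa using (h (p i)).symm, fun h i => by simpa using (h (p.symm i)).symm⟩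

theorem rep_rowSum_conjTranspose (T : Fin n ≃ μ.cells) :
    (rep A n (rowSum T))ᴴ = rep A n (rowSum T) := by
  simp only [rowSum, map_sum, rep_permElt, Matrix.conjTranspose_sum, permOp_conjTranspose]
  exact Finset.sum_equiv (Equiv.inv _) (fun p => inv_mem_rowGroup.symm) fun p _ => rfl

theorem rep_colSum_conjTranspose (T : Fin n ≃ μ.cells) :
    (rep A n (colSum T))ᴴ = rep A n (colSum T) := by
  simp only [colSum, map_sum, map_smul, rep_permElt, Matrix.conjTranspose_sum,
    Matrix.conjTranspose_smul, permOp_conjTranspose]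
  refine Finset.sum_equiv (Equiv.inv _) (fun p => inv_mem_colGroup.symm) fun p _ => ?_
  simp

theorem rep_shapeElt [Fintype (Fin n ≃ μ.cells)] :
    rep A n (shapeElt n μ) =
      ∑ T : Fin n ≃ μ.cells, youngSymmetrizer A T * (youngSymmetrizer A T)ᴴ := by
  simp only [shapeElt, map_sum]
  refine Finset.sum_congr (by congr!) fun T _ => ?_
  rw [← rep_symmetrizer]
  simp only [map_mul, Matrix.conjTranspose_mul, rep_rowSum_conjTranspose, rep_colSum_conjTranspose]

theorem rep_shapeElt_isHermitian : (rep A n (shapeElt n μ)).IsHermitian := by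
  classical
  rw [rep_shapeElt, Matrix.IsHermitian, Matrix.conjTranspose_sum]
  simp

/-- The element `shapeElt n μ` acts as a sum of positive operators `Y Yᴴ`, so it can only act as
zero if every Young symmetrizer `Y` of shape `μ` does. -/
theorem youngSymmetrizer_eq_zero_of_rep_shapeElt (h : rep A n (shapeElt n μ) = 0)
    (T : Fin n ≃ μ.cells) : youngSymmetrizer A T = 0 := by
  classical
  have h1 : ∑ T : Fin n ≃ μ.cells, (youngSymmetrizer A T * (youngSymmetrizer A T)ᴴ).trace = 0 := by
    rw [← Matrix.trace_sum, ← rep_shapeElt, h, Matrix.trace_zero]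
  rw [Finset.sum_eq_zero_iff_of_nonneg fun T _ =>
    (Matrix.posSemidef_self_mul_conjTranspose _).trace_nonneg] at h1
  exact Matrix.trace_mul_conjTranspose_self_eq_zero_iff.1 (h1 T (Finset.mem_univ _))

/-- If the diagram has more rows than `A` has elements, then by the pigeonhole principle every basis
vector has equal factors in two positions of the first column, and antisymmetrization kills it. -/
theorem youngSymmetrizer_eq_zero (h : Fintype.card A < μ.colLen 0) (T : Fin n ≃ μ.cells) :
    youngSymmetrizer A T = 0 := by
  suffices hc : rep A n (colSum T) = 0 by
    rw [← rep_symmetrizer, map_mul, hc, zero_mul]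
  ext x y
  have hcell : ∀ i : Fin (μ.colLen 0), (i.1, 0) ∈ μ.cells := fun i =>
    YoungDiagram.mem_iff_lt_colLen.2 i.2
  obtain ⟨a, b, hab, hy⟩ := Fintype.exists_ne_map_eq_of_card_lt
    (fun i : Fin (μ.colLen 0) => y (T.symm ⟨(i.1, 0), hcell i⟩)) (by simpa using h)
  set i := T.symm ⟨(a.1, 0), hcell a⟩ with hi
  set j := T.symm ⟨(b.1, 0), hcell b⟩ with hj
  have hij : i ≠ j := by
    intro hij
    have := congrArg (fun k => (T k).1.1) hij
    simp only [hi, hj, Equiv.apply_symm_apply] at this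
    exact hab (Fin.ext this)
  have hmem : Equiv.swap i j ∈ colGroup T := swap_mem_colGroup (by simp [hi, hj])
  have h1 := congrArg (rep A n) (colSum_mul_permElt hmem)
  rw [map_mul, map_smul, rep_permElt, Equiv.Perm.sign_swap hij] at h1
  have hswap : y ∘ Equiv.swap i j = y := by
    ext k
    simp only [Function.comp_apply, Equiv.swap_apply_def]
    split_ifs with h3 h4
    · rw [h3]
      exact hy.symm
    · rw [h4]
      exact hy
    · rfl
  have h2 : (rep A n (colSum T) * permOp A (Equiv.swap i j)) x y = rep A n (colSum T) x y := by
    rw [Matrix.mul_apply, Finset.sum_eq_single y]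
    · simp [permOp, hswap]
    · intro z _ hz
      simp [permOp, hswap, hz]
    · simp
  have h3 := congrFun (congrFun h1 x) y
  rw [h2] at h3
  simp only [Matrix.smul_apply] at h3
  have h4 : rep A n (colSum T) x y = - rep A n (colSum T) x y := by
    simpa using h3
  simpa using self_eq_neg.1 h4

/-- The basis vector whose factor at the entry `i` is labelled by the row of `i` is fixed by the row
group, and among the column permutations only the identity fixes it. -/
theorem youngSymmetrizer_ne_zero (h : μ.colLen 0 ≤ Fintype.card A) (T : Fin n ≃ μ.cells) :
    youngSymmetrizer A T ≠ 0 := by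
  obtain ⟨e⟩ : Nonempty (Fin (μ.colLen 0) ↪ A) :=
    Function.Embedding.nonempty_of_card_le (by simpa using h)
  let x : Fin n → A := fun i => e ⟨(T i).1.1, fst_lt_colLen_zero _⟩
  have hx : ∀ π : Equiv.Perm (Fin n), x = x ∘ π.symm ↔ π ∈ rowGroup T := by
    intro π
    rw [← inv_mem_rowGroup, mem_rowGroup, funext_iff]
    refine forall_congr' fun i => ?_
    simp [x, Equiv.Perm.inv_def, eq_comm]
  intro h0
  have h1 : ∀ y, (∑ p ∈ rowGroup T, permOp A p) y x =
      if y = x then ((rowGroup T).card : ℂ) else 0 := by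
    intro y
    rw [Matrix.sum_apply]
    have : ∀ p ∈ rowGroup T, permOp A p y x = if y = x then (1 : ℂ) else 0 := by
      intro p hp
      rw [permOp, Matrix.of_apply, ← (hx p).2 hp]
    rw [Finset.sum_congr rfl this]
    split_ifs <;> simp
  have h2 : (∑ q ∈ colGroup T, ((Equiv.Perm.sign q : ℤ) : ℂ) • permOp A q) x x = 1 := by
    rw [Matrix.sum_apply, Finset.sum_eq_single 1]
    · simp [permOp_one]
    · intro q hq hq1
      have : ¬ x = x ∘ q.symm := by
        intro hxq
        apply hq1
        have hr := mem_rowGroup.1 ((hx q).1 hxq)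
        have hc := mem_colGroup.1 hq
        ext1 i
        exact T.injective (Subtype.ext (Prod.ext (hr i) (hc i)))
      simp [permOp, this]
    · intro h3
      exact absurd (mem_colGroup.2 fun i => rfl) h3
  have h3 := congrFun (congrFun h0 x) x
  rw [youngSymmetrizer, Matrix.mul_apply] at h3
  simp only [h1, mul_ite, mul_zero, Finset.sum_ite_eq', Finset.mem_univ, if_true, h2, one_mul,
    Matrix.zero_apply, Nat.cast_eq_zero, Finset.card_eq_zero] at h3
  exact absurd (h3 ▸ (mem_rowGroup.2 fun i => rfl : (1 : Equiv.Perm (Fin n)) ∈ rowGroup T))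
    (Finset.notMem_empty _)

end Representation

/-! ### Central idempotents -/

section Idempotents

variable {n : ℕ} {μ ν : YoungDiagram}

theorem nonempty_tableau (h : μ.card = n) : Nonempty (Fin n ≃ μ.cells) :=
  ⟨(Fintype.equivFinOfCardEq (by simpa using h)).symm⟩

/-- The square is tested in the representation on `(ℂⁿ)^{⊗ n}`, where the element acts as a
nonzero Hermitian operator. -/
theorem shapeElt_mul_self_ne_zero (h : μ.card = n) : shapeElt n μ * shapeElt n μ ≠ 0 := by
  intro h0
  obtain ⟨T⟩ := nonempty_tableau h
  have hle : μ.colLen 0 ≤ Fintype.card (Fin n) := by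
    rw [Fintype.card_fin, ← h]
    exact colLen_zero_le_card μ
  refine youngSymmetrizer_ne_zero (Fin n) hle T
    (youngSymmetrizer_eq_zero_of_rep_shapeElt (Fin n) ?_ T)
  have h1 := congrArg (rep (Fin n) n) h0
  rw [map_mul, map_zero] at h1
  nth_rewrite 1 [← (rep_shapeElt_isHermitian (Fin n) (n := n) (μ := μ)).eq] at h1
  exact Matrix.conjTranspose_mul_self_eq_zero.1 h1

theorem linearIndependent_shapeElt (n : ℕ) :
    LinearIndependent ℂ fun μ : youngDiagrams n n =>
      (⟨shapeElt n μ.1, shapeElt_mem_center⟩ : Subalgebra.center ℂ (GroupAlg n)) := by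
  rw [Fintype.linearIndependent_iff]
  intro c hc ν
  have h1 := congrArg (fun x : Subalgebra.center ℂ (GroupAlg n) => x.1 * shapeElt n ν.1) hc
  simp only [AddSubmonoidClass.coe_finsetSum, SetLike.val_smul, Finset.sum_mul, smul_mul_assoc,
    ZeroMemClass.coe_zero, zero_mul] at h1
  rw [Finset.sum_eq_single ν] at h1
  · exact (smul_eq_zero.1 h1).resolve_right
      (shapeElt_mul_self_ne_zero (mem_youngDiagrams.1 ν.2).1)
  · intro μ _ hμ
    rw [shapeElt_mul_of_ne fun h => hμ (Subtype.ext h), smul_zero]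
  · simp

/-- The linearly independent elements `shapeElt n μ` are as many as there are conjugacy classes, so
they form a basis of the center. -/
theorem exists_eq_sum_shapeElt {x : GroupAlg n} (hx : x ∈ Subalgebra.center ℂ (GroupAlg n)) :
    ∃ c : YoungDiagram → ℂ, x = ∑ μ ∈ youngDiagrams n n, c μ • shapeElt n μ := by
  have hli := linearIndependent_shapeElt n
  have hcard : Fintype.card (youngDiagrams n n) =
      Module.finrank ℂ (Subalgebra.center ℂ (GroupAlg n)) :=
    le_antisymm hli.fintype_card_le_finrank
      ((finrank_center_le n).trans (by rw [Fintype.card_coe]))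
  have hspan := hli.span_eq_top_of_card_eq_finrank' hcard
  have hmem : (⟨x, hx⟩ : Subalgebra.center ℂ (GroupAlg n)) ∈ Submodule.span ℂ (Set.range
      fun μ : youngDiagrams n n =>
        (⟨shapeElt n μ.1, shapeElt_mem_center⟩ : Subalgebra.center ℂ (GroupAlg n))) := by
    rw [hspan]
    exact Submodule.mem_top
  obtain ⟨c, hc⟩ := (Submodule.mem_span_range_iff_exists_fun ℂ).1 hmem
  classical
  refine ⟨fun μ => if h : μ ∈ youngDiagrams n n then c ⟨μ, h⟩ else 0, ?_⟩
  rw [← Finset.sum_coe_sort]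
  have h1 := congrArg Subtype.val hc
  simp only [AddSubmonoidClass.coe_finsetSum, SetLike.val_smul] at h1
  rw [← h1]
  exact Finset.sum_congr rfl fun μ _ => by simp

/-- The coefficients of the unit of the group algebra in the basis `shapeElt n μ` of the center. -/
noncomputable def unitCoeff (n : ℕ) : YoungDiagram → ℂ :=
  (exists_eq_sum_shapeElt (n := n) (one_mem _)).choose

/-- The central idempotent of type `μ`: the component of the unit along `shapeElt n μ`. -/
noncomputable def centralIdem (n : ℕ) (μ : YoungDiagram) : GroupAlg n :=
  unitCoeff n μ • shapeElt n μ

theorem sum_centralIdem (n : ℕ) : ∑ μ ∈ youngDiagrams n n, centralIdem n μ = 1 :=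
  (exists_eq_sum_shapeElt (n := n) (one_mem _)).choose_spec.symm

theorem centralIdem_mul_of_ne (h : μ ≠ ν) : centralIdem n μ * centralIdem n ν = 0 := by
  rw [centralIdem, centralIdem, smul_mul_smul_comm, shapeElt_mul_of_ne h, smul_zero]

theorem centralIdem_mul_self (h : μ ∈ youngDiagrams n n) :
    centralIdem n μ * centralIdem n μ = centralIdem n μ := by
  have h1 : centralIdem n μ * ∑ ν ∈ youngDiagrams n n, centralIdem n ν = centralIdem n μ := by
    rw [sum_centralIdem, mul_one]
  rwa [Finset.mul_sum, Finset.sum_eq_single_of_mem μ h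
    fun ν _ hν => centralIdem_mul_of_ne hν.symm] at h1

theorem centralIdem_mul_symmetrizer (h : μ ∈ youngDiagrams n n) (T : Fin n ≃ μ.cells) :
    centralIdem n μ * (colSum T * rowSum T) = colSum T * rowSum T := by
  have h1 : (∑ ν ∈ youngDiagrams n n, centralIdem n ν) * (colSum T * rowSum T) =
      colSum T * rowSum T := by
    rw [sum_centralIdem, one_mul]
  rw [Finset.sum_mul, Finset.sum_eq_single_of_mem μ h fun ν _ hν => by
    rw [centralIdem, smul_mul_assoc, shapeElt_mul_symmetrizer_of_ne hν, smul_zero]] at h1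
  exact h1

theorem unitCoeff_ne_zero (h : μ ∈ youngDiagrams n n) : unitCoeff n μ ≠ 0 := by
  intro h0
  have h1 : (∑ ν ∈ youngDiagrams n n, centralIdem n ν) * shapeElt n μ = shapeElt n μ := by
    rw [sum_centralIdem, one_mul]
  rw [Finset.sum_mul, Finset.sum_eq_zero] at h1
  · apply shapeElt_mul_self_ne_zero (mem_youngDiagrams.1 h).1
    rw [← h1, zero_mul]
  · intro ν _
    rcases eq_or_ne ν μ with rfl | hν
    · rw [centralIdem, h0, zero_smul, zero_mul]
    · rw [centralIdem, smul_mul_assoc, shapeElt_mul_of_ne hν, smul_zero]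

theorem exists_eq_sum_centralIdem {x : GroupAlg n} (hx : x ∈ Subalgebra.center ℂ (GroupAlg n)) :
    ∃ c : YoungDiagram → ℂ, x = ∑ μ ∈ youngDiagrams n n, c μ • centralIdem n μ := by
  obtain ⟨c, hc⟩ := exists_eq_sum_shapeElt hx
  refine ⟨fun μ => c μ / unitCoeff n μ, hc.trans (Finset.sum_congr rfl fun μ hμ => ?_)⟩
  rw [centralIdem, smul_smul, div_mul_cancel₀ _ (unitCoeff_ne_zero hμ)]

end Idempotents

/-! ### The isotypic projectors -/

section Projectors

variable (A : Type*) [Fintype A] [DecidableEq A] {n : ℕ} {μ ν : YoungDiagram}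

theorem youngDiagrams_mono {n d : ℕ} (h : μ ∈ youngDiagrams n d) : μ ∈ youngDiagrams n n := by
  have h1 := (mem_youngDiagrams.1 h).1
  exact mem_youngDiagrams.2 ⟨h1, (colLen_zero_le_card μ).trans h1.le⟩

theorem rep_centralIdem_isHermitian (h : μ ∈ youngDiagrams n n) :
    (rep A n (centralIdem n μ)).IsHermitian := by
  -- `Pᴴ = (∑ Q) Pᴴ = P Pᴴ`, since `Pᴴ` is a multiple of `shapeElt n μ`
  have h1 : (rep A n (centralIdem n μ))ᴴ = star (unitCoeff n μ) • rep A n (shapeElt n μ) := by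
    rw [centralIdem, map_smul, Matrix.conjTranspose_smul, (rep_shapeElt_isHermitian A).eq]
  have h2 : centralIdem n μ * shapeElt n μ = shapeElt n μ := by
    have h3 : (∑ ν ∈ youngDiagrams n n, centralIdem n ν) * shapeElt n μ = shapeElt n μ := by
      rw [sum_centralIdem, one_mul]
    rwa [Finset.sum_mul, Finset.sum_eq_single_of_mem μ h fun ν _ hν => by
      rw [centralIdem, smul_mul_assoc, shapeElt_mul_of_ne hν, smul_zero]] at h3
  have h3 : rep A n (centralIdem n μ) * (rep A n (centralIdem n μ))ᴴ =
      (rep A n (centralIdem n μ))ᴴ := by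
    rw [h1, mul_smul_comm, ← map_mul, h2]
  have h4 := congrArg Matrix.conjTranspose h3
  rw [Matrix.conjTranspose_mul, Matrix.conjTranspose_conjTranspose, h3] at h4
  exact h4

theorem range_rep_centralIdem (h : μ ∈ youngDiagrams n n) :
    LinearMap.range (Matrix.toEuclideanLin (rep A n (centralIdem n μ))) = isotypic A n μ := by
  classical
  apply le_antisymm
  · rintro _ ⟨v, rfl⟩
    rw [centralIdem, map_smul, rep_shapeElt, map_smul, map_sum, LinearMap.smul_apply,
      LinearMap.sum_apply]
    refine Submodule.smul_mem _ _ (Submodule.sum_mem _ fun T _ => ?_)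
    refine Submodule.mem_iSup_of_mem T ?_
    rw [Matrix.toLpLin_mul_same]
    exact ⟨_, rfl⟩
  · refine iSup_le fun T => ?_
    rintro _ ⟨v, rfl⟩
    rw [← rep_symmetrizer, ← centralIdem_mul_symmetrizer h, map_mul, Matrix.toLpLin_mul_same]
    exact ⟨_, rfl⟩

theorem isotypicProj_eq_rep (h : μ ∈ youngDiagrams n n) :
    isotypicProj A n μ = rep A n (centralIdem n μ) := by
  rw [isotypicProj, LinearEquiv.symm_apply_eq]
  have hp : (Matrix.toEuclideanLin (rep A n (centralIdem n μ))).IsSymmetricProjection := by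
    refine ⟨?_, ?_⟩
    · rw [IsIdempotentElem, Module.End.mul_eq_comp, ← Matrix.toLpLin_mul_same, ← map_mul,
        centralIdem_mul_self h]
    · exact Matrix.isSymmetric_toEuclideanLin_iff.2 (rep_centralIdem_isHermitian A h)
  have hK : ∀ (K : Submodule ℂ (EuclideanSpace ℂ (Fin n → A))) [K.HasOrthogonalProjection],
      K = isotypic A n μ → K.starProjection.toLinearMap =
        (isotypic A n μ).starProjection.toLinearMap := by
    rintro _ _ rfl
    rfl
  obtain ⟨_, hpr⟩ := LinearMap.isSymmetricProjection_iff_eq_coe_starProjection_range.1 hp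
  exact ((hpr.trans (hK _ (range_rep_centralIdem A h)))).symm

theorem isotypicProj_ne_zero (h : μ ∈ youngDiagrams n (Fintype.card A)) :
    isotypicProj A n μ ≠ 0 := by
  rw [isotypicProj_eq_rep A (youngDiagrams_mono h), centralIdem, map_smul]
  intro h0
  obtain ⟨T⟩ := nonempty_tableau (mem_youngDiagrams.1 h).1
  exact youngSymmetrizer_ne_zero A (mem_youngDiagrams.1 h).2 T
    (youngSymmetrizer_eq_zero_of_rep_shapeElt A
      ((smul_eq_zero.1 h0).resolve_left (unitCoeff_ne_zero (youngDiagrams_mono h))) T)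

theorem isStarProjection_isotypicProj (h : μ ∈ youngDiagrams n n) :
    IsStarProjection (isotypicProj A n μ) := by
  rw [isotypicProj_eq_rep A h]
  refine ⟨?_, rep_centralIdem_isHermitian A h⟩
  rw [IsIdempotentElem, ← map_mul, centralIdem_mul_self h]

theorem isotypicProj_mul_of_ne (hμ : μ ∈ youngDiagrams n n) (hν : ν ∈ youngDiagrams n n)
    (h : μ ≠ ν) : isotypicProj A n μ * isotypicProj A n ν = 0 := by
  rw [isotypicProj_eq_rep A hμ, isotypicProj_eq_rep A hν, ← map_mul, centralIdem_mul_of_ne h,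
    map_zero]

/-- Every central element of the group algebra acts by a scalar on each isotypic subspace; the
diagrams with more than `|A|` rows do not contribute. -/
theorem rep_sum_smul_centralIdem (c : YoungDiagram → ℂ) :
    rep A n (∑ μ ∈ youngDiagrams n n, c μ • centralIdem n μ) =
      ∑ μ ∈ youngDiagrams n (Fintype.card A), c μ • isotypicProj A n μ := by
  rw [map_sum, ← Finset.sum_subset (s₁ := youngDiagrams n (Fintype.card A))
    fun μ hμ => youngDiagrams_mono hμ]
  · refine Finset.sum_congr rfl fun μ hμ => ?_
    rw [map_smul, isotypicProj_eq_rep A (youngDiagrams_mono hμ)]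
  · intro μ hμ hμ'
    classical
    have hlt : Fintype.card A < μ.colLen 0 := by
      by_contra hle
      exact hμ' (mem_youngDiagrams.2 ⟨(mem_youngDiagrams.1 hμ).1, not_lt.1 hle⟩)
    rw [centralIdem, map_smul, map_smul, rep_shapeElt]
    simp [youngSymmetrizer_eq_zero A hlt]

theorem sum_isotypicProj :
    ∑ μ ∈ youngDiagrams n (Fintype.card A), isotypicProj A n μ = 1 := by
  have h := rep_sum_smul_centralIdem A (n := n) fun _ => 1
  simp only [one_smul, sum_centralIdem, map_one] at h
  exact h.symm

end Projectors

/-! ### Permutation traces and Burnside's lemma -/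

section Burnside

attribute [local instance] arrowAction

/-- Two tuples with the same multiset of values differ by a permutation of the positions. -/
theorem exists_perm_of_map_univ_eq {n : ℕ} {B : Type*} {f g : Fin n → B}
    (h : (Finset.univ.val.map f) = Finset.univ.val.map g) :
    ∃ σ : Equiv.Perm (Fin n), ∀ i, g (σ i) = f i := by
  classical
  have hc : ∀ b, Nonempty ({i // f i = b} ≃ {i // g i = b}) := by
    intro b
    have h1 := congrArg (Multiset.count b) h
    rw [Multiset.count_map, Multiset.count_map] at h1
    refine ⟨Fintype.equivOfCardEq ?_⟩
    rw [Fintype.card_subtype, Fintype.card_subtype]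
    simpa [Finset.card_def, Finset.filter_val, eq_comm] using h1
  exact ⟨Equiv.ofFiberEquiv fun b => (hc b).some, fun i => Equiv.ofFiberEquiv_map _ i⟩

/-- The orbits of position permutations on tuples are the multisets of size `n`. -/
theorem card_orbits_tuples (n : ℕ) (B : Type*) [Fintype B] :
    Nat.card (MulAction.orbitRel.Quotient (Equiv.Perm (Fin n)) (Fin n → B)) =
      (Fintype.card B).multichoose n := by
  classical
  rw [← Sym.card_sym_eq_multichoose B n, ← Nat.card_eq_fintype_card]
  let F : (Fin n → B) → Sym B n := fun f => ⟨Finset.univ.val.map f, by simp⟩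
  have hF : ∀ f g : Fin n → B,
      (MulAction.orbitRel (Equiv.Perm (Fin n)) (Fin n → B)) f g ↔ F f = F g := by
    intro f g
    rw [MulAction.orbitRel_apply, MulAction.mem_orbit_iff]
    constructor
    · rintro ⟨σ, rfl⟩
      apply Subtype.ext
      change Finset.univ.val.map (g ∘ (σ⁻¹ : Equiv.Perm (Fin n))) = Finset.univ.val.map g
      rw [← Multiset.map_map, Multiset.map_univ_val_equiv]
    · intro h
      obtain ⟨σ, hσ⟩ := exists_perm_of_map_univ_eq (Subtype.ext_iff.1 h)
      refine ⟨σ⁻¹, ?_⟩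
      ext i
      change g (σ⁻¹⁻¹ i) = f i
      rw [inv_inv, hσ]
  refine Nat.card_congr (Equiv.ofBijective (Quotient.lift F fun f g h => (hF f g).1 h) ⟨?_, ?_⟩)
  · intro a b
    induction a using Quotient.inductionOn
    induction b using Quotient.inductionOn
    exact fun h => Quotient.sound ((hF _ _).2 h)
  · rintro ⟨s, hs⟩
    induction s using Quotient.inductionOn with
    | h l =>
      have hl : l.length = n := by simpa using hs
      subst hl
      refine ⟨Quotient.mk _ l.get, Subtype.ext ?_⟩
      change Finset.univ.val.map l.get = (l : Multiset B)
      simp [Fin.univ_val_map]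

variable (A : Type*) [Fintype A] [DecidableEq A] {n : ℕ}

theorem trace_permOp (π : Equiv.Perm (Fin n)) :
    (permOp A π).trace = (Nat.card {y : Fin n → A // y = y ∘ π.symm} : ℂ) := by
  rw [Matrix.trace, Nat.card_eq_fintype_card, Fintype.card_subtype]
  simp [permOp]

/-- By Burnside's lemma for pairs of basis labels: the square of `tr U(π)` counts the fixed
points of `π` on `(A × A)ⁿ`. -/
theorem sum_trace_permOp_sq :
    ∑ π : Equiv.Perm (Fin n), (permOp A π).trace * (permOp A π).trace =
      ((n + Fintype.card A ^ 2 - 1).choose n : ℂ) * (n.factorial : ℂ) := by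
  classical
  have h1 : ∀ π : Equiv.Perm (Fin n), (permOp A π).trace * (permOp A π).trace =
      (Fintype.card (MulAction.fixedBy (Fin n → A × A) π) : ℂ) := by
    intro π
    rw [trace_permOp, ← Nat.cast_mul, ← Nat.card_prod, ← Nat.card_eq_fintype_card]
    congr 1
    refine Nat.card_congr ⟨fun y => ⟨fun i => (y.1.1 i, y.2.1 i), ?_⟩,
      fun f => (⟨fun i => (f.1 i).1, ?_⟩, ⟨fun i => (f.1 i).2, ?_⟩), fun _ => rfl, fun _ => rfl⟩
    · ext1 i
      exact Prod.ext (congrFun y.1.2.symm i) (congrFun y.2.2.symm i)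
    · ext1 i
      exact congrArg Prod.fst (congrFun f.2 i).symm
    · ext1 i
      exact congrArg Prod.snd (congrFun f.2 i).symm
  rw [Finset.sum_congr rfl fun π _ => h1 π, ← Nat.cast_sum,
    MulAction.sum_card_fixedBy_eq_card_orbits_mul_card_group, ← Nat.card_eq_fintype_card,
    card_orbits_tuples, Fintype.card_perm, Fintype.card_fin, Nat.multichoose_eq, Fintype.card_prod,
    ← sq, add_comm (Fintype.card A ^ 2) n, Nat.cast_mul]

end Burnside

/-! ### Twirling over permutations -/

section Twirl

variable {A : Type*} [Fintype A] [DecidableEq A] {n : ℕ}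

theorem star_trace_permOp (π : Equiv.Perm (Fin n)) :
    star (permOp A π).trace = (permOp A π).trace := by
  rw [trace_permOp]
  simp

theorem permOp_conjTranspose_mul_self (π : Equiv.Perm (Fin n)) :
    (permOp A π)ᴴ * permOp A π = 1 := by
  rw [permOp_conjTranspose, ← permOp_mul, inv_mul_cancel, permOp_one]

theorem permOp_mul_conjTranspose_self (π : Equiv.Perm (Fin n)) :
    permOp A π * (permOp A π)ᴴ = 1 := by
  rw [permOp_conjTranspose, ← permOp_mul, mul_inv_cancel, permOp_one]

theorem isPermInvariant_iff_commute {L : Op A n} :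
    IsPermInvariant L ↔ ∀ π : Equiv.Perm (Fin n), Commute (permOp A π) L := by
  refine forall_congr' fun π => ⟨fun h => ?_, fun h => ?_⟩
  · rw [Commute, SemiconjBy]
    nth_rewrite 2 [← h]
    rw [mul_assoc, permOp_conjTranspose_mul_self, mul_one]
  · rw [h.eq, mul_assoc, permOp_mul_conjTranspose_self, mul_one]

/-- The average of an operator over the conjugates by permutations of the tensor factors. -/
noncomputable def twirl (X : Op A n) : Op A n :=
  (n.factorial : ℂ)⁻¹ • ∑ π : Equiv.Perm (Fin n), permOp A π * X * (permOp A π)ᴴ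

theorem isPermInvariant_twirl (X : Op A n) : IsPermInvariant (twirl X) := by
  intro σ
  have h : permOp A σ * (∑ π : Equiv.Perm (Fin n), permOp A π * X * (permOp A π)ᴴ) *
      (permOp A σ)ᴴ = ∑ π : Equiv.Perm (Fin n), permOp A π * X * (permOp A π)ᴴ := by
    rw [Finset.mul_sum, Finset.sum_mul, ← Equiv.sum_comp (Equiv.mulLeft σ)
      fun π => permOp A π * X * (permOp A π)ᴴ]
    refine Finset.sum_congr rfl fun π _ => ?_
    rw [Equiv.coe_mulLeft, permOp_mul, Matrix.conjTranspose_mul]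
    simp only [mul_assoc]
  rw [twirl, mul_smul_comm, smul_mul_assoc, h]

theorem conjTranspose_twirl (X : Op A n) : (twirl X)ᴴ = twirl Xᴴ := by
  rw [twirl, twirl, Matrix.conjTranspose_smul, Matrix.conjTranspose_sum, star_inv₀, star_natCast]
  congr 1
  refine Finset.sum_congr rfl fun π _ => ?_
  rw [Matrix.conjTranspose_mul, Matrix.conjTranspose_mul, Matrix.conjTranspose_conjTranspose,
    mul_assoc]

theorem trace_mul_twirl {L : Op A n} (hL : IsPermInvariant L) (X : Op A n) :
    (L * twirl X).trace = (L * X).trace := by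
  have h : ∀ π : Equiv.Perm (Fin n), (L * (permOp A π * X * (permOp A π)ᴴ)).trace =
      (L * X).trace := by
    intro π
    rw [← mul_assoc, Matrix.trace_mul_comm, ← mul_assoc L,
      ← (isPermInvariant_iff_commute.1 hL π).eq, mul_assoc, ← mul_assoc _ (permOp A π),
      permOp_conjTranspose_mul_self, one_mul]
  have hn : (n.factorial : ℂ) ≠ 0 := Nat.cast_ne_zero.2 n.factorial_ne_zero
  rw [twirl, mul_smul_comm, Matrix.trace_smul, Finset.mul_sum, Matrix.trace_sum,
    Finset.sum_congr rfl fun π _ => h π, Finset.sum_const, Finset.card_univ, Fintype.card_perm,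
    Fintype.card_fin, nsmul_eq_mul, smul_eq_mul, inv_mul_cancel_left₀ hn]

/-- Bessel's inequality for the Hilbert–Schmidt inner product and a Hermitian unit vector. -/
theorem star_trace_mul_trace_le {S M : Op A n} (hS : S.IsHermitian) (h1 : (S * S).trace = 1) :
    star (S * M).trace * (S * M).trace ≤ (Mᴴ * M).trace := by
  set t := (S * M).trace with ht
  have h2 : (Mᴴ * S).trace = star t := by
    rw [ht, ← Matrix.trace_conjTranspose, Matrix.conjTranspose_mul, hS.eq]
  have h3 := (Matrix.posSemidef_conjTranspose_mul_self (M - t • S)).trace_nonneg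
  rw [Matrix.conjTranspose_sub, Matrix.conjTranspose_smul, hS.eq, sub_mul, mul_sub, mul_sub,
    mul_smul_comm, mul_smul_comm, smul_mul_assoc, smul_mul_assoc, Matrix.trace_sub,
    Matrix.trace_sub, Matrix.trace_sub, Matrix.trace_smul, Matrix.trace_smul, Matrix.trace_smul,
    Matrix.trace_smul, h1, h2, ← ht] at h3
  simp only [smul_eq_mul, mul_one] at h3
  rw [← sub_nonneg]
  convert h3 using 1
  ring

open scoped MatrixOrder in
/-- The positive square root inherits permutation invariance, by its uniqueness. -/
theorem exists_sqrt_isPermInvariant {τ : Op A n} (hτ : τ.PosSemidef) (hinv : IsPermInvariant τ) :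
    ∃ S : Op A n, S.IsHermitian ∧ S * S = τ ∧ IsPermInvariant S := by
  have hS : (CFC.sqrt τ).PosSemidef := Matrix.nonneg_iff_posSemidef.1 (CFC.sqrt_nonneg τ)
  have hsq : CFC.sqrt τ * CFC.sqrt τ = τ := CFC.sqrt_mul_sqrt_self τ hτ.nonneg
  refine ⟨CFC.sqrt τ, hS.1, hsq, fun π => ?_⟩
  have h1 : (permOp A π * CFC.sqrt τ * (permOp A π)ᴴ).PosSemidef :=
    hS.mul_mul_conjTranspose_same _
  refine (CFC.sqrt_unique ?_ h1.nonneg).symm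
  have h2 : permOp A π * CFC.sqrt τ * (permOp A π)ᴴ * (permOp A π * CFC.sqrt τ * (permOp A π)ᴴ) =
      permOp A π * (CFC.sqrt τ * ((permOp A π)ᴴ * permOp A π) * CFC.sqrt τ) * (permOp A π)ᴴ := by
    simp only [mul_assoc]
  rw [h2, permOp_conjTranspose_mul_self, mul_one, hsq, hinv π]

end Twirl

/-! ### The universal operator -/

section UniversalOperator

variable (A : Type*) [Fintype A] [DecidableEq A] (n : ℕ)

/-- The element `∑ tr U(π) π` of the group algebra. Up to normalization its representation is the
partial trace, over the second half of each factor, of the projector onto the symmetric subspace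
of `(ℂ^A ⊗ ℂ^A)^{⊗ n}`. -/
noncomputable def traceElt : GroupAlg n :=
  ∑ π : Equiv.Perm (Fin n), (permOp A π).trace • permElt π

theorem traceElt_mem_center : traceElt A n ∈ Subalgebra.center ℂ (GroupAlg n) := by
  refine mem_center_of_commute_permElt fun g => ?_
  rw [traceElt, Finset.mul_sum, Finset.sum_mul]
  refine Fintype.sum_equiv (MulAut.conj g).toEquiv _ _ fun π => ?_
  have h : (permOp A (g * π * g⁻¹)).trace = (permOp A π).trace := by
    rw [permOp_mul, Matrix.trace_mul_comm, ← permOp_mul, inv_mul_cancel_left]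
  change permElt g * _ = ((permOp A (g * π * g⁻¹)).trace • permElt (g * π * g⁻¹)) * permElt g
  rw [h, mul_smul_comm, smul_mul_assoc]
  simp only [permElt, ← map_mul, inv_mul_cancel_right]

theorem rep_traceElt :
    rep A n (traceElt A n) = ∑ π : Equiv.Perm (Fin n), (permOp A π).trace • (permOp A π)ᴴ := by
  rw [traceElt, map_sum]
  refine Fintype.sum_equiv (Equiv.inv _) _ _ fun π => ?_
  rw [Equiv.inv_apply, ← permOp_conjTranspose, Matrix.conjTranspose_conjTranspose,
    Matrix.trace_conjTranspose, star_trace_permOp, map_smul, rep_permElt]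

theorem rep_traceElt_isHermitian : (rep A n (traceElt A n)).IsHermitian := by
  rw [Matrix.IsHermitian]
  nth_rewrite 1 [rep_traceElt]
  rw [traceElt, Matrix.conjTranspose_sum, map_sum]
  refine Finset.sum_congr rfl fun π _ => ?_
  rw [Matrix.conjTranspose_smul, Matrix.conjTranspose_conjTranspose, star_trace_permOp, map_smul,
    rep_permElt]

/-- The quadratic form at `v` is the squared Hilbert–Schmidt length of the twirled operators
`|v⟩⟨w|`, summed over the basis vectors `w`. -/
theorem dotProduct_rep_traceElt_mulVec (v : (Fin n → A) → ℂ) :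
    star v ⬝ᵥ (((n.factorial : ℂ)⁻¹ • rep A n (traceElt A n)) *ᵥ v) =
      ∑ w, ((twirl (Matrix.vecMulVec v (Pi.single w 1)))ᴴ *
        twirl (Matrix.vecMulVec v (Pi.single w 1))).trace := by
  have h1 : ∀ w, ((twirl (Matrix.vecMulVec v (Pi.single w 1)))ᴴ *
      twirl (Matrix.vecMulVec v (Pi.single w 1))).trace =
      (n.factorial : ℂ)⁻¹ * ∑ π : Equiv.Perm (Fin n),
        permOp A π w w * (star v ⬝ᵥ ((permOp A π)ᴴ *ᵥ v)) := by
    intro w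
    have hinv : IsPermInvariant (twirl (Matrix.vecMulVec v (Pi.single w 1)))ᴴ := by
      rw [conjTranspose_twirl]
      exact isPermInvariant_twirl _
    rw [trace_mul_twirl hinv, conjTranspose_twirl, twirl, smul_mul_assoc, Matrix.trace_smul,
      Finset.sum_mul, Matrix.trace_sum, smul_eq_mul]
    congr 1
    refine Finset.sum_congr rfl fun π _ => ?_
    rw [Matrix.conjTranspose_vecMulVec, Matrix.mul_vecMulVec (permOp A π), Matrix.vecMulVec_mul,
      Matrix.vecMulVec_mul_vecMulVec, Matrix.trace_vecMulVec]
    rw [Matrix.dotProduct_mulVec]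
    simp [mul_comm]
  rw [Finset.sum_congr rfl fun w _ => h1 w, ← Finset.mul_sum, Finset.sum_comm, rep_traceElt,
    Matrix.smul_mulVec, dotProduct_smul, smul_eq_mul, Matrix.sum_mulVec, dotProduct_sum]
  congr 1
  refine Finset.sum_congr rfl fun π _ => ?_
  rw [Matrix.smul_mulVec, dotProduct_smul, smul_eq_mul, Matrix.trace, Finset.sum_mul]
  rfl

theorem posSemidef_rep_traceElt :
    ((n.factorial : ℂ)⁻¹ • rep A n (traceElt A n)).PosSemidef := by
  refine .of_dotProduct_mulVec_nonneg ?_ fun v => ?_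
  · rw [Matrix.IsHermitian, Matrix.conjTranspose_smul, (rep_traceElt_isHermitian A n).eq]
    simp
  · rw [dotProduct_rep_traceElt_mulVec]
    exact Finset.sum_nonneg fun w _ => (Matrix.posSemidef_conjTranspose_mul_self _).trace_nonneg

theorem opLE_rep_traceElt {τ : Op A n} (hτ : IsState τ) (hinv : IsPermInvariant τ) :
    OpLE τ ((n.factorial : ℂ)⁻¹ • rep A n (traceElt A n)) := by
  obtain ⟨S, hS, hSS, hSinv⟩ := exists_sqrt_isPermInvariant hτ.1 hinv
  refine .of_dotProduct_mulVec_nonneg ((posSemidef_rep_traceElt A n).1.sub hτ.1.1) fun v => ?_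
  rw [Matrix.sub_mulVec, dotProduct_sub, sub_nonneg, dotProduct_rep_traceElt_mulVec]
  have h1 : star v ⬝ᵥ (τ *ᵥ v) = ∑ w, star ((S *ᵥ v) w) * (S *ᵥ v) w := by
    rw [← hSS, ← Matrix.mulVec_mulVec, Matrix.dotProduct_mulVec]
    have h2 : star v ᵥ* S = star (S *ᵥ v) := by rw [Matrix.star_mulVec, hS.eq]
    rw [h2]
    rfl
  rw [h1]
  refine Finset.sum_le_sum fun w _ => ?_
  have h2 : (S *ᵥ v) w = (S * twirl (Matrix.vecMulVec v (Pi.single w 1))).trace := by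
    rw [trace_mul_twirl hSinv, Matrix.mul_vecMulVec, Matrix.trace_vecMulVec]
    simp
  rw [h2]
  exact star_trace_mul_trace_le hS (by rw [hSS, hτ.2])

theorem trace_rep_traceElt :
    (rep A n (traceElt A n)).trace =
      ((n + Fintype.card A ^ 2 - 1).choose n : ℂ) * (n.factorial : ℂ) := by
  rw [← sum_trace_permOp_sq A, traceElt, map_sum, Matrix.trace_sum]
  refine Finset.sum_congr rfl fun π _ => ?_
  rw [map_smul, rep_permElt, Matrix.trace_smul, smul_eq_mul]

end UniversalOperator

/-! ### Symmetries of the represented group algebra -/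

section ProductUnitaries

variable {A : Type*} {n : ℕ}

theorem tensorPow_mul [Fintype A] (V W : Matrix A A ℂ) :
    tensorPow n (V * W) = tensorPow n V * tensorPow n W := by
  ext x y
  simp only [tensorPow, Matrix.mul_apply, Matrix.of_apply, ← Finset.prod_mul_distrib]
  rw [Finset.prod_univ_sum, Fintype.piFinset_univ]

theorem tensorPow_one [DecidableEq A] : tensorPow n (1 : Matrix A A ℂ) = 1 := by
  ext x y
  rw [tensorPow, Matrix.of_apply, Matrix.one_apply]
  split_ifs with h
  · exact Finset.prod_eq_one fun i _ => by rw [h, Matrix.one_apply_eq]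
  · obtain ⟨i, hi⟩ := Function.ne_iff.1 h
    exact Finset.prod_eq_zero (Finset.mem_univ i) (Matrix.one_apply_ne hi)

theorem tensorPow_conjTranspose (V : Matrix A A ℂ) : (tensorPow n V)ᴴ = tensorPow n Vᴴ := by
  ext x y
  simp [tensorPow]

variable [Fintype A] [DecidableEq A]

theorem permOp_mul_tensorPow (π : Equiv.Perm (Fin n)) (V : Matrix A A ℂ) :
    permOp A π * tensorPow n V = tensorPow n V * permOp A π := by
  ext x y
  have h : ∀ z : Fin n → A, x = z ∘ π.symm ↔ z = x ∘ π := fun z =>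
    ⟨fun h => by rw [h]; ext i; simp, fun h => by rw [h]; ext i; simp⟩
  simp only [Matrix.mul_apply, permOp, tensorPow, Matrix.of_apply, h, ite_mul, one_mul, zero_mul,
    mul_ite, mul_one, mul_zero, Finset.sum_ite_eq', Finset.mem_univ, if_true]
  refine Fintype.prod_equiv π _ _ fun i => ?_
  simp

theorem commute_rep {L : Op A n} (h : ∀ π : Equiv.Perm (Fin n), Commute (permOp A π) L)
    (x : GroupAlg n) : Commute (rep A n x) L := by
  induction x using MonoidAlgebra.induction_on with
  | of g => rw [rep_permElt]; exact h g
  | add x y hx hy => rw [map_add]; exact hx.add_left hy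
  | smul c x hx => rw [map_smul]; exact hx.smul_left c

theorem isProductUnitaryInvariant_rep (x : GroupAlg n) :
    IsProductUnitaryInvariant (rep A n x) := by
  intro V hV
  rw [← (commute_rep (fun π => permOp_mul_tensorPow π V) x).eq, mul_assoc,
    tensorPow_conjTranspose, ← tensorPow_mul]
  have h : V * Vᴴ = 1 := Matrix.mem_unitaryGroup_iff.1 hV
  rw [h, tensorPow_one, mul_one]

theorem isPermInvariant_rep {x : GroupAlg n} (hx : x ∈ Subalgebra.center ℂ (GroupAlg n)) :
    IsPermInvariant (rep A n x) := by
  rw [isPermInvariant_iff_commute]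
  intro π
  rw [← rep_permElt, Commute, SemiconjBy, ← map_mul, ← map_mul,
    Subalgebra.mem_center_iff.1 hx]

end ProductUnitaries

/-- The weights of a positive combination of orthogonal projectors are nonnegative: compress with
one of the projectors and take the trace. -/
theorem weight_nonneg {A : Type*} [Fintype A] [DecidableEq A] {n : ℕ} {c : YoungDiagram → ℂ}
    (hω : (∑ μ ∈ youngDiagrams n (Fintype.card A), c μ • isotypicProj A n μ).PosSemidef)
    {μ : YoungDiagram} (hμ : μ ∈ youngDiagrams n (Fintype.card A)) : 0 ≤ c μ := by
  have hP := isStarProjection_isotypicProj A (youngDiagrams_mono hμ)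
  have hH : (isotypicProj A n μ)ᴴ = isotypicProj A n μ := hP.isSelfAdjoint
  have hPP : isotypicProj A n μ * isotypicProj A n μ = isotypicProj A n μ := hP.isIdempotentElem
  have h1 := hω.conjTranspose_mul_mul_same (isotypicProj A n μ)
  rw [mul_assoc, Finset.sum_mul, Finset.sum_eq_single_of_mem μ hμ fun ν hν hne => by
    rw [smul_mul_assoc, isotypicProj_mul_of_ne A (youngDiagrams_mono hν) (youngDiagrams_mono hμ)
      hne, smul_zero], smul_mul_assoc, mul_smul_comm, hH, hPP, hPP] at h1
  have h2 := h1.trace_nonneg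
  have hpsd : (isotypicProj A n μ).PosSemidef := by
    have := Matrix.posSemidef_conjTranspose_mul_self (isotypicProj A n μ)
    rwa [hH, hPP] at this
  have h3 : 0 < (isotypicProj A n μ).trace :=
    lt_of_le_of_ne hpsd.trace_nonneg fun h =>
      isotypicProj_ne_zero A hμ (hpsd.trace_eq_zero_iff.1 h.symm)
  rw [Matrix.trace_smul, smul_eq_mul] at h2
  exact le_of_mul_le_mul_right (by rwa [zero_mul]) h3

end UniversalState

theorem mainTheorem9 {A : Type*} [Fintype A] [DecidableEq A] (d : ℕ) (hd : 1 ≤ d)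
    (hA : Fintype.card A = d) (n : ℕ) :
    ∃ ω : UniversalState.Op A n,
      UniversalState.IsState ω ∧
      -- domination of all permutation invariant states
      (∀ τ : UniversalState.Op A n,
        UniversalState.IsState τ → UniversalState.IsPermInvariant τ →
          UniversalState.OpLE τ (((n + d ^ 2 - 1).choose n : ℂ) • ω)) ∧
      (n + d ^ 2 - 1).choose n ≤ (n + 1) ^ (d ^ 2 - 1) ∧
      -- mutually orthogonal nonzero projectors that decompose the space
      (∀ μ ∈ UniversalState.youngDiagrams n d,
        IsStarProjection (UniversalState.isotypicProj A n μ) ∧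
          UniversalState.isotypicProj A n μ ≠ 0) ∧
      (∀ μ ∈ UniversalState.youngDiagrams n d, ∀ ν ∈ UniversalState.youngDiagrams n d, μ ≠ ν →
        UniversalState.isotypicProj A n μ * UniversalState.isotypicProj A n ν = 0) ∧
      (∑ μ ∈ UniversalState.youngDiagrams n d, UniversalState.isotypicProj A n μ = 1) ∧
      -- the eigenvalue decomposition; the weights `p μ * tr (P μ)` form a probability distribution
      (∃ p : YoungDiagram → ℝ,
        (∀ μ ∈ UniversalState.youngDiagrams n d, 0 ≤ p μ) ∧
        (∑ μ ∈ UniversalState.youngDiagrams n d,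
          (p μ : ℂ) * (UniversalState.isotypicProj A n μ).trace = 1) ∧
        ω = ∑ μ ∈ UniversalState.youngDiagrams n d,
          (p μ : ℂ) • UniversalState.isotypicProj A n μ) ∧
      (UniversalState.youngDiagrams n d).card ≤ (n + 1) ^ (d - 1) ∧
      UniversalState.IsPermInvariant ω ∧
      UniversalState.IsProductUnitaryInvariant ω ∧
      (∀ τ : UniversalState.Op A n,
        UniversalState.IsState τ → UniversalState.IsPermInvariant τ → Commute ω τ) := by
  open UniversalState in
  open scoped ComplexOrder in
  subst hA
  have hsq : 1 ≤ Fintype.card A ^ 2 := Nat.one_le_pow _ _ hd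
  set g : ℕ := (n + Fintype.card A ^ 2 - 1).choose n with hg
  have hg0 : (g : ℂ) ≠ 0 := Nat.cast_ne_zero.2 (Nat.choose_pos (by omega)).ne'
  have hn0 : (n.factorial : ℂ) ≠ 0 := Nat.cast_ne_zero.2 n.factorial_ne_zero
  let x : GroupAlg n := ((g : ℂ)⁻¹ * (n.factorial : ℂ)⁻¹) • traceElt A n
  have hx : x ∈ Subalgebra.center ℂ (GroupAlg n) :=
    Subalgebra.smul_mem _ (traceElt_mem_center A n) _
  have hgx : (g : ℂ) • rep A n x = (n.factorial : ℂ)⁻¹ • rep A n (traceElt A n) := by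
    rw [map_smul, smul_smul, mul_inv_cancel_left₀ hg0]
  have hpsd : (rep A n x).PosSemidef := by
    have h : rep A n x = (g : ℂ)⁻¹ • ((n.factorial : ℂ)⁻¹ • rep A n (traceElt A n)) := by
      rw [← hgx, inv_smul_smul₀ hg0]
    rw [h]
    exact (posSemidef_rep_traceElt A n).smul (by positivity)
  have htr : (rep A n x).trace = 1 := by
    rw [map_smul, Matrix.trace_smul, trace_rep_traceElt A n, ← hg, smul_eq_mul]
    field_simp
  obtain ⟨c, hc⟩ := exists_eq_sum_centralIdem hx
  have hsum : rep A n x = ∑ μ ∈ youngDiagrams n (Fintype.card A), c μ • isotypicProj A n μ := by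
    conv_lhs => rw [hc]
    exact rep_sum_smul_centralIdem A c
  have hc0 : ∀ μ ∈ youngDiagrams n (Fintype.card A), 0 ≤ c μ := fun μ hμ =>
    weight_nonneg (hsum ▸ hpsd) hμ
  have hre : ∀ μ ∈ youngDiagrams n (Fintype.card A), ((c μ).re : ℂ) = c μ := fun μ hμ =>
    (Complex.eq_re_of_ofReal_le (r := 0) (by simpa using hc0 μ hμ)).symm
  have hsum' : rep A n x =
      ∑ μ ∈ youngDiagrams n (Fintype.card A), ((c μ).re : ℂ) • isotypicProj A n μ :=
    hsum.trans (Finset.sum_congr rfl fun μ hμ => by rw [hre μ hμ])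
  refine ⟨rep A n x, ⟨hpsd, htr⟩, ?_, ?_, ?_, ?_, sum_isotypicProj A,
    ⟨fun μ => (c μ).re, ?_, ?_, hsum'⟩, card_youngDiagrams_le hd n, isPermInvariant_rep hx,
    isProductUnitaryInvariant_rep x, ?_⟩
  · intro τ hτ hinv
    rw [hgx]
    exact opLE_rep_traceElt A n hτ hinv
  · rw [hg, Nat.add_sub_assoc hsq]
    exact choose_add_le_pow _ _
  · exact fun μ hμ =>
      ⟨isStarProjection_isotypicProj A (youngDiagrams_mono hμ), isotypicProj_ne_zero A hμ⟩
  · exact fun μ hμ ν hν h =>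
      isotypicProj_mul_of_ne A (youngDiagrams_mono hμ) (youngDiagrams_mono hν) h
  · exact fun μ hμ => (Complex.le_def.1 (hc0 μ hμ)).1
  · rw [← htr, hsum', Matrix.trace_sum]
    exact Finset.sum_congr rfl fun μ _ => by rw [Matrix.trace_smul, smul_eq_mul]
  · exact fun τ _ hinv => commute_rep (isPermInvariant_iff_commute.1 hinv) x
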